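/- Let $K$ be a field of characteristic zero and let $D=\frac{d}{dt}$ be the usual derivation of $K(t)$, so that $K(t)[D]$ is the ring of linear differential operators $\sum_i a_iD^i$ with $a_i\in K(t)$ and $Da=aD+a'$. Let $m\ge 2$, let $T,Q_1,\dots,Q_m\in K[t]$, and put $S'=\deg T$ and $r'_j=\deg Q_j$, where $\deg 0=-\infty$. Assume that $$S'\ge 0,\qquad r'_m=S'+1,\qquad r'_j<r'_m\quad\text{for } j=1,\dots,m-1,$$ or that $$r'_m\ge 0,\qquad S'=r'_m+1,\qquad r'_j\le r'_m\quad\text{for } j=1,\dots,m.$$ Then the differential operator $$E(D,t)=T D^m-Q_1D^{m-1}-\cdots-Q_m$$ is irreducible in the ring $K(t)[D]$: it is not a unit, and it is not a product of two non-units (equivalently, it is nonzero of positive order and is not a product of two operators of strictly smaller order). -/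

import Mathlib

open Polynomial
open scoped Differential

/-! ### The ring of linear differential operators over a differential ring -/

/-- Elements of `R[∂]`, the linear differential operators `∑ aᵢ ∂ⁱ` with coefficients `aᵢ` in a
differential ring `R`; the operator is recorded by the polynomial `∑ aᵢ Xⁱ` of its (left)
coefficients. -/
@[ext]
structure DiffOp (R : Type*) [CommRing R] where
  ofCoeffs ::
  coeffs : R[X]

namespace DiffOp

noncomputable section

section AddGroup

variable {R : Type*} [CommRing R]

/-- A differential operator is the same as its polynomial of left coefficients. -/
def equivCoeffs (R : Type*) [CommRing R] : DiffOp R ≃ R[X] where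
  toFun := coeffs
  invFun := ofCoeffs
  left_inv _ := rfl
  right_inv _ := rfl

instance : AddCommGroup (DiffOp R) := (equivCoeffs R).addCommGroup

theorem coeffs_add (p q : DiffOp R) : (p + q).coeffs = p.coeffs + q.coeffs := rfl
theorem coeffs_zero : (0 : DiffOp R).coeffs = 0 := rfl
theorem coeffs_neg (p : DiffOp R) : (-p).coeffs = -p.coeffs := rfl
theorem coeffs_sub (p q : DiffOp R) : (p - q).coeffs = p.coeffs - q.coeffs := rfl

end AddGroup

/-- The identity operator. -/
instance {R : Type*} [CommRing R] : One (DiffOp R) := ⟨⟨1⟩⟩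

theorem coeffs_one {R : Type*} [CommRing R] : (1 : DiffOp R).coeffs = 1 := rfl

variable {R : Type*} [CommRing R] [Differential R]

/-- Composition with `∂` from the left, on coefficient polynomials:
`∂ (∑ bⱼ ∂ʲ) = ∑ (bⱼ′ ∂ʲ + bⱼ ∂ʲ⁺¹)`. -/
def leftD (R : Type*) [CommRing R] [Differential R] : R[X] →+ R[X] :=
  (Differential.mapCoeffs : Derivation ℤ R[X] R[X]).toLinearMap.toAddMonoidHom
    + AddMonoidHom.mulRight X

theorem leftD_apply (q : R[X]) : leftD R q = Differential.mapCoeffs q + q * X := rfl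

/-- Composition with `∑ aᵢ ∂ⁱ` from the left: `q ↦ ∑ aᵢ ∂ⁱ q`. -/
def leftMul (p q : R[X]) : R[X] := p.sum fun i a => C a * (leftD R)^[i] q

/-- The product of differential operators. -/
instance : Mul (DiffOp R) := ⟨fun p q => ⟨leftMul p.coeffs q.coeffs⟩⟩

theorem coeffs_mul (p q : DiffOp R) : (p * q).coeffs = leftMul p.coeffs q.coeffs := rfl

theorem leftMul_monomial (i : ℕ) (a : R) (q : R[X]) :
    leftMul (monomial i a) q = C a * (leftD R)^[i] q := by
  simp [leftMul, sum_monomial_index]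

theorem add_leftMul (p p' q : R[X]) : leftMul (p + p') q = leftMul p q + leftMul p' q := by
  unfold leftMul
  exact sum_add_index _ _ _ (by simp) (by intros; rw [C_add, add_mul])

theorem zero_leftMul (q : R[X]) : leftMul 0 q = 0 := by simp [leftMul]

theorem leftMul_add (p q q' : R[X]) : leftMul p (q + q') = leftMul p q + leftMul p q' := by
  simp [leftMul, iterate_map_add, mul_add, Polynomial.sum, Finset.sum_add_distrib]

theorem leftMul_zero (p : R[X]) : leftMul p 0 = 0 := by
  simp [leftMul, iterate_map_zero, Polynomial.sum]

theorem leftD_monomial (i : ℕ) (a : R) :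
    leftD R (monomial i a) = monomial i (a′) + monomial (i + 1) a := by
  rw [leftD_apply, monomial_mul_X]
  simp

theorem leftD_C_mul (a : R) (q : R[X]) : leftD R (C a * q) = C (a′) * q + C a * leftD R q := by
  simp only [leftD_apply, Derivation.leibniz, Differential.mapCoeffs_C, smul_eq_mul]
  ring

theorem C_mul_leftMul (a : R) (p q : R[X]) : leftMul (C a * p) q = C a * leftMul p q := by
  induction p using Polynomial.induction_on' with
  | add p p' h h' => rw [mul_add, add_leftMul, h, h', add_leftMul, mul_add]
  | monomial i b => rw [C_mul_monomial, leftMul_monomial, leftMul_monomial, C_mul, mul_assoc]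

theorem leftD_leftMul (p q : R[X]) : leftMul (leftD R p) q = leftD R (leftMul p q) := by
  induction p using Polynomial.induction_on' with
  | add p p' h h' => rw [map_add, add_leftMul, h, h', add_leftMul, map_add]
  | monomial i b =>
    rw [leftD_monomial, add_leftMul, leftMul_monomial, leftMul_monomial, leftMul_monomial,
      leftD_C_mul, Function.iterate_succ_apply']

theorem leftMul_assoc (p q r : R[X]) : leftMul (leftMul p q) r = leftMul p (leftMul q r) := by
  induction p using Polynomial.induction_on' with
  | add p p' h h' => rw [add_leftMul, add_leftMul, h, h', add_leftMul]
  | monomial i b =>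
    rw [leftMul_monomial, leftMul_monomial, C_mul_leftMul]
    congr 1
    induction i with
    | zero => rfl
    | succ n ih => rw [Function.iterate_succ_apply', Function.iterate_succ_apply',
        leftD_leftMul, ih]

theorem one_leftMul (q : R[X]) : leftMul 1 q = q := by
  rw [← monomial_zero_one, leftMul_monomial]; simp

theorem iterate_leftD_one (i : ℕ) : (leftD R)^[i] 1 = X ^ i := by
  induction i with
  | zero => simp
  | succ n ih =>
    rw [Function.iterate_succ_apply', ih, ← monomial_one_right_eq_X_pow, leftD_monomial,
      ← monomial_one_right_eq_X_pow]
    simp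

theorem leftMul_one (p : R[X]) : leftMul p 1 = p := by
  simp only [leftMul, iterate_leftD_one]
  exact p.sum_C_mul_X_pow_eq

/-- The ring `R[∂]` of linear differential operators. -/
instance : Ring (DiffOp R) :=
  { (inferInstance : AddCommGroup (DiffOp R)) with
    mul := (· * ·)
    one := 1
    left_distrib := fun p q r => DiffOp.ext (leftMul_add p.coeffs q.coeffs r.coeffs)
    right_distrib := fun p q r => DiffOp.ext (add_leftMul p.coeffs q.coeffs r.coeffs)
    zero_mul := fun p => DiffOp.ext (zero_leftMul p.coeffs)
    mul_zero := fun p => DiffOp.ext (leftMul_zero p.coeffs)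
    mul_assoc := fun p q r => DiffOp.ext (leftMul_assoc p.coeffs q.coeffs r.coeffs)
    one_mul := fun p => DiffOp.ext (one_leftMul p.coeffs)
    mul_one := fun p => DiffOp.ext (leftMul_one p.coeffs) }

/-- The operator of order zero: multiplication by `a`. -/
def const (a : R) : DiffOp R := ⟨C a⟩

/-- The operator `∂`. -/
def D : DiffOp R := ⟨X⟩

/-- The defining commutation rule `∂ a = a ∂ + a′`. -/
theorem D_mul_const (a : R) : (D : DiffOp R) * const a = const a * D + const (a′) := by
  apply DiffOp.ext
  simp only [coeffs_add, coeffs_mul, D, const, ← monomial_one_one_eq_X, ← monomial_zero_left,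
    leftMul_monomial, Function.iterate_one, Function.iterate_zero, id, leftD_monomial]
  simp [C_mul_monomial, add_comm]

theorem coeffs_D_pow (i : ℕ) : ((D : DiffOp R) ^ i).coeffs = X ^ i := by
  induction i with
  | zero => rfl
  | succ n ih =>
    have hD : (D : DiffOp R).coeffs = monomial 1 1 := monomial_one_one_eq_X.symm
    rw [pow_succ', coeffs_mul, ih, hD, leftMul_monomial, ← monomial_one_right_eq_X_pow,
      Function.iterate_one, leftD_monomial, ← monomial_one_right_eq_X_pow]
    simp

/-- Every operator is uniquely a sum of terms `a ∂ⁱ`. -/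
theorem coeffs_const_mul_D_pow (a : R) (i : ℕ) :
    (const a * (D : DiffOp R) ^ i).coeffs = monomial i a := by
  rw [coeffs_mul, coeffs_D_pow, const, ← monomial_zero_left, leftMul_monomial,
    Function.iterate_zero, id, C_mul_X_pow_eq_monomial]

end

end DiffOp

/-! ### The field `K(t)` with the derivation `d/dt` -/

namespace RatFuncDeriv

noncomputable section

/-- An additive map satisfying the Leibniz rule, as a differential ring structure. -/
@[reducible]
def differentialOfLeibniz {A : Type*} [CommRing A] (d : A → A)
    (hadd : ∀ a b, d (a + b) = d a + d b) (hmul : ∀ a b, d (a * b) = a * d b + b * d a) :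
    Differential A where
  deriv := Derivation.mk' (AddMonoidHom.mk' d hadd).toIntLinearMap hmul

variable {K : Type*} [Field K]

/-- The derivative `d/dt` of a rational function, by the quotient rule. -/
def dt (f : RatFunc K) : RatFunc K :=
  (algebraMap K[X] (RatFunc K) (derivative f.num) * algebraMap K[X] (RatFunc K) f.denom
      - algebraMap K[X] (RatFunc K) f.num * algebraMap K[X] (RatFunc K) (derivative f.denom))
    / algebraMap K[X] (RatFunc K) f.denom ^ 2

theorem dt_eq {f : RatFunc K} {p q : K[X]} (hq : q ≠ 0)
    (hf : f = algebraMap K[X] (RatFunc K) p / algebraMap K[X] (RatFunc K) q) :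
    dt f = (algebraMap K[X] (RatFunc K) (derivative p) * algebraMap K[X] (RatFunc K) q
      - algebraMap K[X] (RatFunc K) p * algebraMap K[X] (RatFunc K) (derivative q))
      / algebraMap K[X] (RatFunc K) q ^ 2 := by
  have hq' : algebraMap K[X] (RatFunc K) q ≠ 0 := RatFunc.algebraMap_ne_zero hq
  have hd' : algebraMap K[X] (RatFunc K) f.denom ≠ 0 := RatFunc.algebraMap_ne_zero f.denom_ne_zero
  have key : f.num * q = p * f.denom := by
    apply RatFunc.algebraMap_injective K
    have h1 := RatFunc.num_div_denom f
    replace h1 := h1.trans hf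
    rw [div_eq_div_iff hd' hq'] at h1
    simpa using h1
  have hder : derivative f.num * q + f.num * derivative q
      = derivative p * f.denom + p * derivative f.denom := by
    simpa [derivative_mul] using congrArg derivative key
  have key' := congrArg (algebraMap K[X] (RatFunc K)) key
  have hder' := congrArg (algebraMap K[X] (RatFunc K)) hder
  simp only [map_mul, map_add] at key' hder'
  rw [dt, div_eq_div_iff (pow_ne_zero 2 hd') (pow_ne_zero 2 hq')]
  generalize algebraMap K[X] (RatFunc K) (derivative f.num) = n' at *
  generalize algebraMap K[X] (RatFunc K) f.num = n at *
  generalize algebraMap K[X] (RatFunc K) (derivative f.denom) = d' at *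
  generalize algebraMap K[X] (RatFunc K) f.denom = d at *
  generalize algebraMap K[X] (RatFunc K) (derivative p) = P' at *
  generalize algebraMap K[X] (RatFunc K) p = P at *
  generalize algebraMap K[X] (RatFunc K) (derivative q) = Q' at *
  generalize algebraMap K[X] (RatFunc K) q = Q at *
  linear_combination (d * Q) * hder' - (Q' * d + d' * Q) * key'

theorem exists_div (f : RatFunc K) : ∃ p q : K[X], q ≠ 0 ∧
    f = algebraMap K[X] (RatFunc K) p / algebraMap K[X] (RatFunc K) q :=
  ⟨f.num, f.denom, f.denom_ne_zero, (RatFunc.num_div_denom f).symm⟩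

theorem dt_add (f g : RatFunc K) : dt (f + g) = dt f + dt g := by
  obtain ⟨p, q, hq, hf⟩ := exists_div f
  obtain ⟨r, s, hs, hg⟩ := exists_div g
  have hq' : algebraMap K[X] (RatFunc K) q ≠ 0 := RatFunc.algebraMap_ne_zero hq
  have hs' : algebraMap K[X] (RatFunc K) s ≠ 0 := RatFunc.algebraMap_ne_zero hs
  have hfg : f + g = algebraMap K[X] (RatFunc K) (p * s + q * r)
      / algebraMap K[X] (RatFunc K) (q * s) := by
    rw [hf, hg, div_add_div _ _ hq' hs']; simp only [map_add, map_mul]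
  rw [dt_eq hq hf, dt_eq hs hg, dt_eq (mul_ne_zero hq hs) hfg]
  simp only [derivative_mul, map_add, map_mul]
  field_simp
  ring

theorem dt_mul (f g : RatFunc K) : dt (f * g) = f * dt g + g * dt f := by
  obtain ⟨p, q, hq, hf⟩ := exists_div f
  obtain ⟨r, s, hs, hg⟩ := exists_div g
  have hq' : algebraMap K[X] (RatFunc K) q ≠ 0 := RatFunc.algebraMap_ne_zero hq
  have hs' : algebraMap K[X] (RatFunc K) s ≠ 0 := RatFunc.algebraMap_ne_zero hs
  have hfg : f * g = algebraMap K[X] (RatFunc K) (p * r)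
      / algebraMap K[X] (RatFunc K) (q * s) := by
    rw [hf, hg, div_mul_div_comm]; simp only [map_mul]
  rw [dt_eq hq hf, dt_eq hs hg, dt_eq (mul_ne_zero hq hs) hfg, hf, hg]
  simp only [derivative_mul, map_add, map_mul]
  field_simp
  ring

/-- `K(t)` as a differential field, with derivation `d/dt`. -/
instance : Differential (RatFunc K) := differentialOfLeibniz dt dt_add dt_mul

theorem deriv_eq_dt (f : RatFunc K) : f′ = dt f := rfl

/-- On polynomials the derivation is the formal derivative. -/
theorem deriv_algebraMap (p : K[X]) :
    (algebraMap K[X] (RatFunc K) p)′ = algebraMap K[X] (RatFunc K) (derivative p) := by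
  rw [deriv_eq_dt, dt_eq (p := p) (q := 1) one_ne_zero (by simp)]
  simp

end

end RatFuncDeriv

/-- The differential operator `E(D, t) = T D^m - Q₁ D^(m-1) - ⋯ - Q_m` in `K(t)[D]`,
with polynomial coefficients `T, Q₁, …, Q_m ∈ K[t]` and `D = d/dt`. -/
noncomputable def operatorE {K : Type*} [Field K] (m : ℕ) (T : K[X]) (Q : ℕ → K[X]) :
    DiffOp (RatFunc K) :=
  DiffOp.const (algebraMap K[X] (RatFunc K) T) * DiffOp.D ^ m
    - ∑ j ∈ Finset.Icc 1 m, DiffOp.const (algebraMap K[X] (RatFunc K) (Q j)) * DiffOp.D ^ (m - j)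

/-! This is an Eisenstein-type argument with the Newton polygon at infinity. Give `t` weight `m` and
`D` weight `e = 1` (first hypothesis) or `e = -1` (second). Since `m + e ≥ 1`, commuting `D` past a
coefficient produces only terms of lower weight, so leading parts multiply as commuting polynomials
(`leftMul_sub_mul`).

The degree conditions say exactly that `T D^m` and `Q_m` both attain the top weight of `E`. Suppose
`E = A B` with both orders strictly between `0` and `m`. As `e` is prime to `m`, distinct powers of
`D` below `m` have weights distinct mod `m`, so `A` and `B` each have a single dominant term
(`exists_dominant_term`). Their product is then the only dominant term of `E`, a contradiction
(`irreducible_of_weightLE`). -/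

namespace RatFunc

/-! ### Degree of a derivative -/

variable {K : Type*} [Field K]

/-- Differentiation of rational functions lowers the degree. -/
theorem intDegree_deriv_lt {f : RatFunc K} (hf : f′ ≠ 0) :
    intDegree (f′) < f.intDegree := by
  set N : K[X] := derivative f.num * f.denom - f.num * derivative f.denom with hN
  have hd : algebraMap K[X] (RatFunc K) (f.denom ^ 2) ≠ 0 :=
    RatFunc.algebraMap_ne_zero (pow_ne_zero 2 f.denom_ne_zero)
  have heq : f′ = algebraMap K[X] (RatFunc K) N / algebraMap K[X] (RatFunc K) (f.denom ^ 2) := by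
    rw [RatFuncDeriv.deriv_eq_dt, RatFuncDeriv.dt, hN]
    simp only [map_sub, map_mul, map_pow]
  have hN0 : algebraMap K[X] (RatFunc K) N ≠ 0 := by
    intro h0
    exact hf (by rw [heq, h0, zero_div])
  have hN1 : N ≠ 0 := fun h0 => hN0 (by rw [h0, map_zero])
  have hn0 : f.num ≠ 0 := fun h0 => hN1 (by rw [hN, h0]; simp)
  -- The quotient-rule numerator has smaller degree than `num * denom`; dividing by `denom ^ 2`
  -- turns this into the bound by `deg num - deg denom`.
  have hlt : N.degree < (f.num * f.denom).degree := by
    refine lt_of_le_of_lt (degree_sub_le _ _) (max_lt ?_ ?_)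
    · rw [degree_mul, degree_mul]
      exact WithBot.add_lt_add_right (degree_ne_bot.mpr f.denom_ne_zero) (degree_derivative_lt hn0)
    · rw [degree_mul, degree_mul]
      exact WithBot.add_lt_add_left (degree_ne_bot.mpr hn0) (degree_derivative_lt f.denom_ne_zero)
  have hlt' := natDegree_lt_natDegree hN1 hlt
  rw [natDegree_mul hn0 f.denom_ne_zero] at hlt'
  rw [heq, intDegree_div hN0 hd, intDegree_polynomial, intDegree_polynomial, natDegree_pow,
    intDegree]
  push_cast
  omega

end RatFunc

/-! ### Weight filtration on operators -/

namespace DiffOp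

variable {K : Type*} [Field K] {c e n k : ℤ} {p q : (RatFunc K)[X]}

/-- All terms `a ∂ⁱ` have weight at most `n`, where `t` has weight `c` and `∂` has weight `e`. -/
def WeightLE (c e n : ℤ) (p : (RatFunc K)[X]) : Prop :=
  -- Zero coefficients must be exempt, because `intDegree 0 = 0`.
  ∀ i, p.coeff i ≠ 0 → c * (p.coeff i).intDegree + e * i ≤ n

namespace WeightLE

theorem zero : WeightLE c e n (0 : (RatFunc K)[X]) := fun i hi => absurd (coeff_zero i) hi

theorem mono (hp : WeightLE c e n p) (h : n ≤ k) : WeightLE c e k p :=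
  fun i hi => (hp i hi).trans h

theorem neg (hp : WeightLE c e n p) : WeightLE c e n (-p) := by
  intro i hi
  rw [coeff_neg] at hi ⊢
  rw [RatFunc.intDegree_neg]
  exact hp i (neg_ne_zero.mp hi)

theorem add (hc : 0 ≤ c) (hp : WeightLE c e n p) (hq : WeightLE c e n q) :
    WeightLE c e n (p + q) := by
  intro i hi
  rw [coeff_add] at hi ⊢
  by_cases hp0 : p.coeff i = 0
  · rw [hp0, zero_add] at hi ⊢
    exact hq i hi
  by_cases hq0 : q.coeff i = 0
  · rw [hq0, add_zero] at hi ⊢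
    exact hp i hi
  have h1 := hp i hp0
  have h2 := hq i hq0
  rcases le_max_iff.mp (RatFunc.intDegree_add_le hq0 hi) with h | h
  · linarith [mul_le_mul_of_nonneg_left h hc]
  · linarith [mul_le_mul_of_nonneg_left h hc]

theorem sub (hc : 0 ≤ c) (hp : WeightLE c e n p) (hq : WeightLE c e n q) :
    WeightLE c e n (p - q) := by
  rw [sub_eq_add_neg]
  exact add hc hp hq.neg

theorem sum {ι : Type*} (hc : 0 ≤ c) (s : Finset ι) (f : ι → (RatFunc K)[X])
    (h : ∀ i ∈ s, WeightLE c e n (f i)) : WeightLE c e n (∑ i ∈ s, f i) :=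
  Finset.sum_induction f (WeightLE c e n) (fun _ _ => add hc) zero h

theorem C_mul {a : RatFunc K} (ha : a ≠ 0) (hq : WeightLE c e n q)
    (h : c * a.intDegree + n ≤ k) : WeightLE c e k (C a * q) := by
  intro i hi
  rw [coeff_C_mul] at hi ⊢
  have hq0 := right_ne_zero_of_mul hi
  rw [RatFunc.intDegree_mul ha hq0]
  linarith [hq i hq0]

theorem mul_X_pow (hq : WeightLE c e n q) (i : ℕ) : WeightLE c e (n + e * i) (q * X ^ i) := by
  intro j hj
  rw [coeff_mul_X_pow'] at hj ⊢
  split_ifs at hj ⊢ with hij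
  · have := hq _ hj
    rw [Nat.cast_sub hij] at this
    linarith
  · exact absurd rfl hj

theorem mul_X (hq : WeightLE c e n q) : WeightLE c e (n + e) (q * X) := by
  simpa using hq.mul_X_pow 1

theorem mul (hc : 0 ≤ c) (hp : WeightLE c e n p) (hq : WeightLE c e k q) :
    WeightLE c e (n + k) (p * q) := by
  rw [← p.sum_C_mul_X_pow_eq, Polynomial.sum, Finset.sum_mul]
  refine sum hc _ _ fun i hi => ?_
  have hi' := mem_support_iff.mp hi
  rw [mul_assoc, mul_comm (X ^ i)]
  exact C_mul hi' (hq.mul_X_pow i) (by linarith [hp i hi'])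

theorem monomial_iff {a : RatFunc K} (ha : a ≠ 0) (i : ℕ) :
    WeightLE c e n (monomial i a) ↔ c * a.intDegree + e * i ≤ n := by
  refine ⟨fun h => by simpa using h i (by simpa using ha), fun h j hj => ?_⟩
  rw [coeff_monomial] at hj ⊢
  split_ifs at hj ⊢ with hij
  · rwa [← hij]
  · exact absurd rfl hj

theorem mapCoeffs (hc : 0 ≤ c) (hq : WeightLE c e n q) :
    WeightLE c e (n - c) (Differential.mapCoeffs q) := by
  intro i hi
  rw [Differential.coeff_mapCoeffs] at hi ⊢
  have hq0 : q.coeff i ≠ 0 := fun h0 => hi (by rw [h0, map_zero])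
  have := mul_le_mul_of_nonneg_left (Int.add_one_le_of_lt (RatFunc.intDegree_deriv_lt hi)) hc
  linarith [hq i hq0]

/-- Each `∂` multiplies by `X`, up to differentiating coefficients. Differentiation costs weight `c`
where `X` would add `e`, so the error lies `c + e ≥ 1` below the main term. -/
theorem iterate_leftD_sub (hc : 0 ≤ c) (hce : 1 ≤ c + e) (hq : WeightLE c e n q) (i : ℕ) :
    WeightLE c e (n + e * i - 1) ((leftD (RatFunc K))^[i] q - q * X ^ i) := by
  induction i with
  | zero => simpa using zero
  | succ i ih =>
    have hD : WeightLE c e (n + e * i) ((leftD (RatFunc K))^[i] q) := by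
      have := add hc (ih.mono (sub_one_lt _).le) (hq.mul_X_pow i)
      rwa [sub_add_cancel] at this
    rw [Function.iterate_succ_apply', leftD_apply, pow_succ, ← mul_assoc,
      add_sub_assoc (Differential.mapCoeffs _), ← sub_mul]
    push_cast
    exact add hc ((hD.mapCoeffs hc).mono (by linarith)) (ih.mul_X.mono (by linarith))

/-- Up to terms of lower weight, differential operators multiply like commutative polynomials. -/
theorem leftMul_sub_mul (hc : 0 ≤ c) (hce : 1 ≤ c + e) (hp : WeightLE c e n p)
    (hq : WeightLE c e k q) : WeightLE c e (n + k - 1) (leftMul p q - p * q) := by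
  have hpq : p * q = ∑ i ∈ p.support, C (p.coeff i) * (q * X ^ i) := by
    conv_lhs => rw [← p.sum_C_mul_X_pow_eq, Polynomial.sum, Finset.sum_mul]
    exact Finset.sum_congr rfl fun i _ => by ring
  rw [hpq, leftMul, Polynomial.sum, ← Finset.sum_sub_distrib]
  refine sum hc _ _ fun i hi => ?_
  have hi' := mem_support_iff.mp hi
  rw [← mul_sub]
  exact C_mul hi' (iterate_leftD_sub hc hce hq i) (by linarith [hp i hi'])

end WeightLE

/-! ### Additivity of the order, and units -/

theorem weightLE_natDegree (p : (RatFunc K)[X]) : WeightLE 0 1 p.natDegree p := by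
  intro i hi
  have := le_natDegree_of_ne_zero hi
  simpa using this

theorem natDegree_leftMul (hp : p ≠ 0) (hq : q ≠ 0) :
    (leftMul p q).natDegree = p.natDegree + q.natDegree := by
  -- With `c = 0` and `e = 1` the weight is the order.
  have h := WeightLE.leftMul_sub_mul le_rfl (by norm_num) (weightLE_natDegree p)
    (weightLE_natDegree q)
  have hpq : p * q ≠ 0 := mul_ne_zero hp hq
  have hdeg : (leftMul p q - p * q).degree < (p * q).degree := by
    rw [degree_eq_natDegree hpq, degree_lt_iff_coeff_zero, natDegree_mul hp hq]
    intro i hi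
    by_contra h0
    have := h i h0
    omega
  have hdeg' := degree_add_eq_right_of_degree_lt hdeg
  rw [sub_add_cancel] at hdeg'
  rw [natDegree_eq_of_degree_eq hdeg', natDegree_mul hp hq]

theorem const_mul_const {R : Type*} [CommRing R] [Differential R] (a b : R) :
    const a * const b = const (a * b) := by
  apply DiffOp.ext
  rw [coeffs_mul, const, const, const, ← monomial_zero_left, leftMul_monomial,
    Function.iterate_zero, id, ← C.map_mul]

theorem isUnit_of_natDegree_eq_zero {A : DiffOp (RatFunc K)} (h0 : A.coeffs ≠ 0)
    (h : A.coeffs.natDegree = 0) : IsUnit A := by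
  obtain ⟨a, ha⟩ := natDegree_eq_zero.mp h
  have hA : A = const a := DiffOp.ext ha.symm
  have ha0 : a ≠ 0 := by
    rintro rfl
    exact h0 (by rw [← ha, map_zero])
  have h1 : const (1 : RatFunc K) = 1 := DiffOp.ext C_1
  refine ⟨⟨const a, const a⁻¹, ?_, ?_⟩, hA.symm⟩
  · rw [const_mul_const, mul_inv_cancel₀ ha0, h1]
  · rw [const_mul_const, inv_mul_cancel₀ ha0, h1]

/-! ### Dominant terms and the irreducibility criterion -/

/-- If `e` is prime to `m`, an operator of order less than `m` has exactly one term of highest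
weight, where `t` has weight `m` and `∂` has weight `e`. -/
theorem exists_dominant_term {m : ℕ} (he : IsCoprime (m : ℤ) e) (hp : p ≠ 0)
    (hdeg : p.natDegree < m) :
    ∃ (i : ℕ) (a : RatFunc K), a ≠ 0 ∧
      WeightLE m e (m * a.intDegree + e * i - 1) (p - monomial i a) := by
  obtain ⟨i, hi, hmax⟩ := p.support.exists_max_image
    (fun i : ℕ => (m : ℤ) * (p.coeff i).intDegree + e * i) (support_nonempty.mpr hp)
  refine ⟨i, p.coeff i, mem_support_iff.mp hi, fun j hj => ?_⟩
  rw [coeff_sub, coeff_monomial] at hj ⊢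
  split_ifs at hj ⊢ with hij
  · subst hij
    exact absurd (sub_self _) hj
  rw [sub_zero] at hj ⊢
  refine Int.le_sub_one_of_lt (lt_of_le_of_ne (hmax j (mem_support_iff.mpr hj)) fun heq => hij ?_)
  -- Equal weights force `m ∣ j - i`, while `|j - i| < m`.
  have hdvd : (m : ℤ) ∣ e * ((j : ℤ) - i) :=
    ⟨(p.coeff i).intDegree - (p.coeff j).intDegree, by linear_combination heq⟩
  have hdvd' := he.dvd_of_dvd_mul_left hdvd
  have hi' := le_natDegree_of_mem_supp i hi
  have hj' := le_natDegree_of_ne_zero hj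
  have := Int.eq_zero_of_abs_lt_dvd hdvd' (abs_lt.mpr ⟨by omega, by omega⟩)
  omega

/-- An operator of order `m` whose terms of order `0` and `m` both have the highest weight is
irreducible, if `t` has weight `m` and the weight of `∂` is prime to `m`. -/
theorem irreducible_of_weightLE {m : ℕ} {W : ℤ} (hm : 0 < m) (hme : 1 ≤ (m : ℤ) + e)
    (he : IsCoprime (m : ℤ) e) {L : DiffOp (RatFunc K)} (hdeg : L.coeffs.natDegree = m)
    (hL : WeightLE m e W L.coeffs)
    (h0 : L.coeffs.coeff 0 ≠ 0) (hW0 : W ≤ m * (L.coeffs.coeff 0).intDegree)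
    (hWm : W ≤ m * (L.coeffs.coeff m).intDegree + e * m) : Irreducible L := by
  have hL0 : L.coeffs ≠ 0 := fun h => h0 (by rw [h, coeff_zero])
  refine ⟨?_, fun {A B} hAB => ?_⟩
  · intro hu
    obtain ⟨V, hV⟩ := hu.exists_right_inv
    have hV0 : V.coeffs ≠ 0 := by
      intro h
      have := congrArg coeffs hV
      rw [coeffs_mul, h, leftMul_zero, coeffs_one] at this
      exact zero_ne_one this
    have := natDegree_leftMul hL0 hV0
    rw [← coeffs_mul, hV, coeffs_one, natDegree_one] at this
    omega
  have hLAB : L.coeffs = leftMul A.coeffs B.coeffs := by rw [hAB, coeffs_mul]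
  have hA : A.coeffs ≠ 0 := fun h => hL0 (by rw [hLAB, h, zero_leftMul])
  have hB : B.coeffs ≠ 0 := fun h => hL0 (by rw [hLAB, h, leftMul_zero])
  have hsum := natDegree_leftMul hA hB
  rw [← hLAB, hdeg] at hsum
  by_cases hA' : A.coeffs.natDegree = 0
  · exact Or.inl (isUnit_of_natDegree_eq_zero hA hA')
  by_cases hB' : B.coeffs.natDegree = 0
  · exact Or.inr (isUnit_of_natDegree_eq_zero hB hB')
  exfalso
  obtain ⟨i, a, ha, hAi⟩ := exists_dominant_term he hA (by omega)
  obtain ⟨j, b, hb, hBj⟩ := exists_dominant_term he hB (by omega)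
  have hab := mul_ne_zero ha hb
  set x : ℤ := m * a.intDegree + e * i with hx
  set y : ℤ := m * b.intDegree + e * j with hy
  have hxy : x + y = m * (a * b).intDegree + e * (i + j : ℕ) := by
    rw [RatFunc.intDegree_mul ha hb, hx, hy]
    push_cast
    ring
  have hm0 : (0 : ℤ) ≤ m := Int.natCast_nonneg m
  have hMa : WeightLE m e x (monomial i a) := (WeightLE.monomial_iff ha i).mpr le_rfl
  have hMb : WeightLE m e y (monomial j b) := (WeightLE.monomial_iff hb j).mpr le_rfl
  have hAx : WeightLE m e x A.coeffs := by
    have := (hAi.mono (sub_one_lt x).le).add hm0 hMa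
    rwa [sub_add_cancel] at this
  have hBy : WeightLE m e y B.coeffs := by
    have := (hBj.mono (sub_one_lt y).le).add hm0 hMb
    rwa [sub_add_cancel] at this
  have hdiff : WeightLE m e (x + y - 1) (L.coeffs - monomial (i + j) (a * b)) := by
    have h1 := hAx.leftMul_sub_mul hm0 hme hBy
    have h2 := (hAi.mul hm0 hBy).mono (by linarith : x - 1 + y ≤ x + y - 1)
    have h3 := (hMa.mul hm0 hBj).mono (by linarith : x + (y - 1) ≤ x + y - 1)
    -- With `M`, `N` the dominant terms of `A`, `B`: `L - M N` is the noncommutativity error plus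
    -- `(A - M) B + M (B - N)`.
    convert (h1.add hm0 h2).add hm0 h3 using 1
    rw [hLAB, ← monomial_mul_monomial]
    ring
  -- The exponent `i + j` cannot equal both `0` and `m`, so one of the two top-weight terms of `L`
  -- survives in the difference.
  have hW : W ≤ x + y - 1 := by
    by_cases hij : i + j = 0
    · have hc : (L.coeffs - monomial (i + j) (a * b)).coeff m = L.coeffs.coeff m := by
        rw [coeff_sub, coeff_monomial, if_neg (by omega), sub_zero]
      have := hdiff m (by rw [hc, ← hdeg]; exact leadingCoeff_ne_zero.mpr hL0)
      rw [hc] at this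
      linarith
    · have hc : (L.coeffs - monomial (i + j) (a * b)).coeff 0 = L.coeffs.coeff 0 := by
        rw [coeff_sub, coeff_monomial, if_neg hij, sub_zero]
      have := hdiff 0 (by rwa [hc])
      rw [hc] at this
      push_cast at this
      linarith
  -- Now `L`, hence also the monomial of weight `x + y`, would have weight at most `x + y - 1`.
  have hM := (hL.mono hW).sub hm0 hdiff
  rw [sub_sub_cancel, WeightLE.monomial_iff hab] at hM
  linarith

end DiffOp

/-! ### Coefficients and weights of `E` -/

section operatorE

variable {K : Type*} [Field K] (m : ℕ) (T : K[X]) (Q : ℕ → K[X])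

theorem coeff_operatorE (k : ℕ) : (operatorE m T Q).coeffs.coeff k =
    (if m = k then algebraMap K[X] (RatFunc K) T else 0) -
      ∑ j ∈ Finset.Icc 1 m, if m - j = k then algebraMap K[X] (RatFunc K) (Q j) else 0 := by
  have hsum : ∀ (s : Finset ℕ) (f : ℕ → DiffOp (RatFunc K)),
      (∑ j ∈ s, f j).coeffs = ∑ j ∈ s, (f j).coeffs := fun s f =>
    map_sum (AddMonoidHom.mk' (DiffOp.coeffs : DiffOp (RatFunc K) → _) DiffOp.coeffs_add) f s
  simp only [operatorE, DiffOp.coeffs_sub, hsum, DiffOp.coeffs_const_mul_D_pow, coeff_sub,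
    finsetSum_coeff, coeff_monomial]

theorem coeff_operatorE_self :
    (operatorE m T Q).coeffs.coeff m = algebraMap K[X] (RatFunc K) T := by
  rw [coeff_operatorE, if_pos rfl, Finset.sum_eq_zero, sub_zero]
  intro j hj
  rw [Finset.mem_Icc] at hj
  exact if_neg (by omega)

theorem coeff_operatorE_of_lt {k : ℕ} (hk : k < m) :
    (operatorE m T Q).coeffs.coeff k = -algebraMap K[X] (RatFunc K) (Q (m - k)) := by
  rw [coeff_operatorE, if_neg hk.ne', zero_sub, Finset.sum_eq_single (m - k),
    if_pos (by omega)]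
  · intro j hj hjk
    rw [Finset.mem_Icc] at hj
    exact if_neg (by omega)
  · intro h
    rw [Finset.mem_Icc] at h
    omega

theorem coeff_operatorE_of_gt {k : ℕ} (hk : m < k) : (operatorE m T Q).coeffs.coeff k = 0 := by
  rw [coeff_operatorE, if_neg hk.ne, Finset.sum_eq_zero, sub_zero]
  intro j _
  exact if_neg (by omega)

variable {m T Q}

theorem natDegree_operatorE (hT : T ≠ 0) : (operatorE m T Q).coeffs.natDegree = m := by
  refine natDegree_eq_of_le_of_coeff_ne_zero ?_ ?_
  · exact natDegree_le_iff_coeff_eq_zero.mpr fun k hk => coeff_operatorE_of_gt m T Q hk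
  · rw [coeff_operatorE_self]
    exact RatFunc.algebraMap_ne_zero hT

theorem weightLE_operatorE {e W : ℤ} (hT : m * (T.natDegree : ℤ) + e * m ≤ W)
    (hQ : ∀ j, 1 ≤ j → j ≤ m → Q j ≠ 0 → m * ((Q j).natDegree : ℤ) + e * (m - j) ≤ W) :
    DiffOp.WeightLE m e W (operatorE m T Q).coeffs := by
  intro k hk
  rcases lt_trichotomy k m with hkm | rfl | hkm
  · rw [coeff_operatorE_of_lt m T Q hkm] at hk ⊢
    rw [RatFunc.intDegree_neg, RatFunc.intDegree_polynomial]
    have hQ0 : Q (m - k) ≠ 0 := fun h => hk (by rw [h, map_zero, neg_zero])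
    have := hQ (m - k) (by omega) (by omega) hQ0
    rwa [Nat.cast_sub hkm.le, sub_sub_cancel] at this
  · rwa [coeff_operatorE_self, RatFunc.intDegree_polynomial]
  · exact absurd (coeff_operatorE_of_gt m T Q hkm) hk

/-- The Newton polygon condition: `T D^m` and `Q_m` span an edge of weight `W`, and no intermediate
term lies above it. Both cases of the theorem reduce to this. -/
theorem irreducible_operatorE {e W : ℤ} (hm : 0 < m) (hme : 1 ≤ (m : ℤ) + e)
    (he : IsCoprime (m : ℤ) e) (hT0 : T ≠ 0) (hQ0 : Q m ≠ 0)
    (hT : m * (T.natDegree : ℤ) + e * m = W) (hQm : m * ((Q m).natDegree : ℤ) = W)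
    (hQ : ∀ j, 1 ≤ j → j < m → Q j ≠ 0 → m * ((Q j).natDegree : ℤ) + e * (m - j) ≤ W) :
    Irreducible (operatorE m T Q) := by
  have h0 : (operatorE m T Q).coeffs.coeff 0 = -algebraMap K[X] (RatFunc K) (Q m) :=
    coeff_operatorE_of_lt m T Q hm
  refine DiffOp.irreducible_of_weightLE hm hme he (natDegree_operatorE hT0)
    (weightLE_operatorE hT.le fun j hj hjm hj0 => ?_) ?_ ?_ ?_
  · rcases hjm.lt_or_eq with h | rfl
    · exact hQ j hj h hj0
    · rw [sub_self, mul_zero, add_zero, hQm]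
  · rw [h0]
    exact neg_ne_zero.mpr (RatFunc.algebraMap_ne_zero hQ0)
  · rw [h0, RatFunc.intDegree_neg, RatFunc.intDegree_polynomial, hQm]
  · rw [coeff_operatorE_self, RatFunc.intDegree_polynomial, hT]

end operatorE

theorem mainTheorem4 {K : Type*} [Field K] [CharZero K] (m : ℕ) (hm : 2 ≤ m)
    (T : K[X]) (Q : ℕ → K[X])
    (h : (0 ≤ T.degree ∧ (Q m).degree = T.degree + 1 ∧
            ∀ j, 1 ≤ j → j ≤ m - 1 → (Q j).degree < (Q m).degree) ∨
         (0 ≤ (Q m).degree ∧ T.degree = (Q m).degree + 1 ∧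
            ∀ j, 1 ≤ j → j ≤ m → (Q j).degree ≤ (Q m).degree)) :
    Irreducible (operatorE m T Q) := by
  rcases h with ⟨hT, hQm, hQ⟩ | ⟨hQm, hT, hQ⟩
  · have hT0 := zero_le_degree_iff.mp hT
    have hd : (Q m).natDegree = T.natDegree + 1 := by
      rw [degree_eq_natDegree hT0] at hQm
      exact natDegree_eq_of_degree_eq_some (by exact_mod_cast hQm)
    have hQ0 : Q m ≠ 0 := fun h0 => by simp [h0] at hd
    -- Here `deg Q_m = deg T + 1`, so `m deg T + m = m deg Q_m`.
    refine irreducible_operatorE (e := 1) (W := m * (T.natDegree + 1)) (by omega) (by omega)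
      isCoprime_one_right hT0 hQ0 (by ring) (by rw [hd]; push_cast; ring) fun j hj hjm hj0 => ?_
    have hlt := natDegree_lt_natDegree hj0 (hQ j hj (by omega))
    have hle : ((Q j).natDegree : ℤ) ≤ T.natDegree := by omega
    have := mul_le_mul_of_nonneg_left hle (Int.natCast_nonneg m)
    linarith [(Int.natCast_nonneg j)]
  · have hQ0 := zero_le_degree_iff.mp hQm
    have hd : T.natDegree = (Q m).natDegree + 1 := by
      rw [degree_eq_natDegree hQ0] at hT
      exact natDegree_eq_of_degree_eq_some (by exact_mod_cast hT)
    have hT0 : T ≠ 0 := fun h0 => by simp [h0] at hd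
    -- Here `m deg T - m = m deg Q_m`; the requirement `m + e ≥ 1` becomes `m ≥ 2`.
    refine irreducible_operatorE (e := -1) (W := m * (Q m).natDegree) (by omega) (by omega)
      isCoprime_one_right.neg_right hT0 hQ0 (by rw [hd]; push_cast; ring) rfl
      fun j hj hjm hj0 => ?_
    have hle : ((Q j).natDegree : ℤ) ≤ (Q m).natDegree :=
      Nat.cast_le.mpr (natDegree_le_natDegree (hQ j hj hjm.le))
    have := mul_le_mul_of_nonneg_left hle (Int.natCast_nonneg m)
    have : (j : ℤ) < m := Nat.cast_lt.mpr hjm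
    linarith
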